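/- Let $\mathbf v=(v_1,\dots,v_t)$ be any vector of nonnegative integers, let $n=v_1+\cdots+v_t$, and let $M(\mathbf v)$ be the set of all permutations of the multiset $\{1^{v_1}2^{v_2}\cdots t^{v_t}\}$, that is, of all words $\pi=\pi_1\pi_2\cdots\pi_n$ in which each letter $i\in\{1,\dots,t\}$ occurs exactly $v_i$ times. A descent of $\pi$ is an index $i$ with $1\le i<n$ and $\pi_i>\pi_{i+1}$; let $\operatorname{des}(\pi)$ be the number of descents of $\pi$ and $\operatorname{maj}(\pi)$ the sum of the descents of $\pi$. Then for every integer $k\ge 0$ the polynomial $$f(q)=\sum_{\pi\in M(\mathbf v),\ \operatorname{des}(\pi)=k} q^{\operatorname{maj}(\pi)}$$ is either identically zero, or, written as $f(q)=\sum_{j=M}^{N}a_jq^j$ with $a_M\ne0$ and $a_N\ne0$, it has all of the following properties: - (nonnegativity) its coefficients $a_j$ are nonnegative integers; - (symmetry) $a_{M+j}=a_{N-j}$ for $0\le j\le N-M$; - (unimodality) there is $p$ with $M\le p\le N$ and $a_M\le a_{M+1}\le\cdots\le a_p\ge a_{p+1}\ge\cdots\ge a_N$; - (darga) $M+N=nk$.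 -/

import Mathlib

namespace QEulerian

open Polynomial

/-- `f` is symmetric: writing `f = ∑_{j=M}^{N} a_j q^j` with `a_M, a_N ≠ 0`, one has
`a_{M+k} = a_{N-k}` for `0 ≤ k ≤ N - M`. (Meant for `f ≠ 0`.) -/
def IsSymmetric (f : ℤ[X]) : Prop :=
  ∀ k ≤ f.natDegree - f.natTrailingDegree,
    f.coeff (f.natTrailingDegree + k) = f.coeff (f.natDegree - k)

/-- `f` is unimodal: writing `f = ∑_{j=M}^{N} a_j q^j` with `a_M, a_N ≠ 0`, there is `p` with
`M ≤ p ≤ N` and `a_M ≤ a_{M+1} ≤ ⋯ ≤ a_p ≥ a_{p+1} ≥ ⋯ ≥ a_N`. (Meant for `f ≠ 0`.) -/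
def IsUnimodal (f : ℤ[X]) : Prop :=
  ∃ p, f.natTrailingDegree ≤ p ∧ p ≤ f.natDegree ∧
    (∀ j, f.natTrailingDegree ≤ j → j < p → f.coeff j ≤ f.coeff (j + 1)) ∧
    (∀ j, p ≤ j → j < f.natDegree → f.coeff (j + 1) ≤ f.coeff j)

/-- The sum of the lowest and the highest exponent occurring in `f`. (Meant for `f ≠ 0`.) -/
def darga (f : ℤ[X]) : ℕ := f.natTrailingDegree + f.natDegree

/-- `f` is zero, or has nonnegative coefficients and is symmetric and unimodal of darga `d`. -/
def IsZSU (d : ℕ) (f : ℤ[X]) : Prop :=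
  f = 0 ∨ ((∀ j, 0 ≤ f.coeff j) ∧ IsSymmetric f ∧ IsUnimodal f ∧ darga f = d)

/-- `M(v)`: the words of length `n = ∑ i, v i` with exactly `v i` letters `i`, for each `i`. -/
def multisetPerms {t : ℕ} (v : Fin t → ℕ) : Finset (Fin (∑ i, v i) → Fin t) :=
  {σ | ∀ i, Finset.card {j | σ j = i} = v i}

/-- The descents of the word `σ = σ_1 ⋯ σ_n`: all `i` with `1 ≤ i < n` and `σ_i > σ_{i+1}`.
The letter `σ_i` is `σ ⟨i - 1, _⟩`, as `Fin n` starts at `0`. -/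
def descents {n t : ℕ} (σ : Fin n → Fin t) : Finset ℕ :=
  {i ∈ Finset.range n | ∃ h : 1 ≤ i ∧ i < n, σ ⟨i - 1, by omega⟩ > σ ⟨i, h.2⟩}

/-- The number of descents. -/
def des {n t : ℕ} (σ : Fin n → Fin t) : ℕ := (descents σ).card

/-- The major index: the sum of the descents. -/
def maj {n t : ℕ} (σ : Fin n → Fin t) : ℕ := ∑ i ∈ descents σ, i

/-- The generating polynomial of `maj` over the words in `M(v)` with exactly `k` descents. -/
noncomputable def qEulerian {t : ℕ} (v : Fin t → ℕ) (k : ℕ) : ℤ[X] :=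
  ∑ σ ∈ multisetPerms v with des σ = k, X ^ maj σ

end QEulerian

namespace QEulerian

open Polynomial Finset

/-! Write `[N, r]` for `gauss N r`. MacMahon's identity `prod_boxPoly_eq_sum_qEulerian` reads `∏
[v_i + s, v_i] = ∑_k f_k [n + s - k, n]`, the sum being over `k ≤ s` and `f_k` being the polynomial
in question. Over all `s` this is a unitriangular system, so it determines the `f_k`
(`eq_of_sum_mul_gauss_eq`), and any expansion of this shape with good coefficients proves the
theorem.

Such an expansion is built one letter at a time. The `q`-Pfaff–Saalschütz formula
`gauss_mul_gauss_eq_sum` expands `[n + b, b] [m + k + b, m]` in the `[n + m + b - i, b - i]` with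
coefficients `q^(i(k+i)) [n - k, i] [m + k, k + i]`. Multiplied by an old coefficient of darga `nk`,
this has darga `(n + m)(k + i)`, which depends only on the new index `k + i`. Hence all
contributions to one new coefficient have the same centre and may be added.

Being nonnegative, symmetric and unimodal about `d / 2` means being a nonnegative combination of
strings centred there, and products of strings are again such combinations (`mul_mem_stringCone`).
What remains is that Gaussian binomials are unimodal; this comes from an `sl₂` action on polynomials
(`card_box_le_succ`). -/

/-! ### Centred strings and their products -/

/-- The polynomial `1 + q + ⋯ + q ^ (n - 1)`. -/
noncomputable def qInt (n : ℕ) : ℤ[X] := ∑ i ∈ range n, X ^ i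

theorem qInt_mul_sub_one (n : ℕ) : qInt n * (X - 1) = X ^ n - 1 := geom_sum_mul X n

theorem X_sub_one_ne_zero : (X - 1 : ℤ[X]) ≠ 0 := by
  simpa using X_sub_C_ne_zero (1 : ℤ)

theorem qInt_ne_zero (n : ℕ) : qInt (n + 1) ≠ 0 := by
  intro h
  have h1 := congrArg (fun p : ℤ[X] => p.eval 1) h
  simp [qInt, eval_finsetSum] at h1
  omega

theorem qInt_add (a b : ℕ) : qInt (a + b) = qInt a + X ^ a * qInt b := by
  simp only [qInt, sum_range_add, mul_sum, pow_add]

/-- One step of the Clebsch–Gordan rule: the longest string splits off, leaving a shifted product of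
shorter strings. It is checked after multiplication by `(X - 1)^2`. -/
theorem qInt_mul_qInt (a b : ℕ) :
    qInt (a + 1) * qInt (b + 1) = qInt (a + b + 1) + X * (qInt a * qInt b) := by
  apply mul_right_cancel₀ (mul_ne_zero X_sub_one_ne_zero X_sub_one_ne_zero)
  have h1 := qInt_mul_sub_one (a + 1)
  have h2 := qInt_mul_sub_one (b + 1)
  have h3 := qInt_mul_sub_one (a + b + 1)
  have h4 := qInt_mul_sub_one a
  have h5 := qInt_mul_sub_one b
  calc _ = (qInt (a + 1) * (X - 1)) * (qInt (b + 1) * (X - 1)) := by ring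
    _ = (qInt (a + b + 1) * (X - 1)) * (X - 1) +
        X * ((qInt a * (X - 1)) * (qInt b * (X - 1))) := by
      rw [h1, h2, h3, h4, h5]; ring
    _ = _ := by ring

theorem coeff_qInt (n j : ℕ) : (qInt n).coeff j = if j < n then 1 else 0 := by
  simp [qInt, finsetSum_coeff, coeff_X_pow]

/-- The nonnegative integer combinations of the strings `q ^ i + q ^ (i + 1) + ⋯ + q ^ (d - i)`. -/
noncomputable def stringCone (d : ℕ) : AddSubmonoid ℤ[X] :=
  AddSubmonoid.closure {f | ∃ i l, 2 * i + l = d ∧ f = X ^ i * qInt (l + 1)}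

theorem string_mem_stringCone (i l : ℕ) : X ^ i * qInt (l + 1) ∈ stringCone (2 * i + l) :=
  AddSubmonoid.subset_closure ⟨i, l, rfl, rfl⟩

theorem qInt_mem_stringCone (l : ℕ) : qInt (l + 1) ∈ stringCone l := by
  simpa using string_mem_stringCone 0 l

theorem one_mem_stringCone : (1 : ℤ[X]) ∈ stringCone 0 := by
  simpa [qInt] using qInt_mem_stringCone 0

theorem X_pow_mul_mem_stringCone {d : ℕ} {f : ℤ[X]} (hf : f ∈ stringCone d) (e : ℕ) :
    X ^ e * f ∈ stringCone (2 * e + d) := by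
  induction hf using AddSubmonoid.closure_induction with
  | mem f hf =>
    obtain ⟨i, l, rfl, rfl⟩ := hf
    rw [← mul_assoc, ← pow_add, ← add_assoc, ← mul_add]
    exact string_mem_stringCone _ _
  | zero => simp
  | add f g _ _ hf hg => rw [mul_add]; exact add_mem hf hg

theorem qInt_mul_qInt_mem_stringCone (a b : ℕ) :
    qInt (a + 1) * qInt (b + 1) ∈ stringCone (a + b) := by
  induction a generalizing b with
  | zero => simpa [qInt] using qInt_mem_stringCone b
  | succ a ih =>
    cases b with
    | zero => simpa [qInt] using qInt_mem_stringCone (a + 1)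
    | succ b =>
      rw [qInt_mul_qInt]
      refine add_mem (qInt_mem_stringCone _) ?_
      have h := X_pow_mul_mem_stringCone (ih b) 1
      rw [pow_one] at h
      convert h using 2
      ring

/-- By bilinearity two strings suffice, and their product is a power of `X` times a product of two
`q`-integers. -/
theorem mul_mem_stringCone {d e : ℕ} {f g : ℤ[X]} (hf : f ∈ stringCone d)
    (hg : g ∈ stringCone e) : f * g ∈ stringCone (d + e) := by
  induction hf using AddSubmonoid.closure_induction with
  | mem f hf =>
    obtain ⟨i, l, rfl, rfl⟩ := hf
    induction hg using AddSubmonoid.closure_induction with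
    | mem g hg =>
      obtain ⟨j, k, rfl, rfl⟩ := hg
      have h := X_pow_mul_mem_stringCone (qInt_mul_qInt_mem_stringCone l k) (i + j)
      convert h using 1
      · ring_nf
      · ring
    | zero => simp
    | add f g _ _ hf hg => rw [mul_add]; exact add_mem hf hg
  | zero => simp
  | add f g _ _ hf hg => rw [add_mul]; exact add_mem hf hg

/-! ### Symmetric unimodal polynomials as sums of strings -/

/-- Coefficientwise form of being nonnegative, symmetric and unimodal around `d / 2`. -/
structure CoeffSU (d : ℕ) (f : ℤ[X]) : Prop where
  nonneg : ∀ j, 0 ≤ f.coeff j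
  eq_zero : ∀ j, d < j → f.coeff j = 0
  symm : ∀ i j, i + j = d → f.coeff i = f.coeff j
  le_succ : ∀ j, 2 * j < d → f.coeff j ≤ f.coeff (j + 1)

theorem CoeffSU.zero (d : ℕ) : CoeffSU d 0 := by constructor <;> simp

theorem CoeffSU.add {d : ℕ} {f g : ℤ[X]} (hf : CoeffSU d f) (hg : CoeffSU d g) :
    CoeffSU d (f + g) where
  nonneg j := by simpa using add_nonneg (hf.nonneg j) (hg.nonneg j)
  eq_zero j hj := by simp [hf.eq_zero j hj, hg.eq_zero j hj]
  symm i j h := by simp [hf.symm i j h, hg.symm i j h]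
  le_succ j h := by simpa using add_le_add (hf.le_succ j h) (hg.le_succ j h)

theorem coeff_string (i l j : ℕ) :
    (X ^ i * qInt (l + 1)).coeff j = if i ≤ j ∧ j ≤ i + l then 1 else 0 := by
  rw [coeff_X_pow_mul']
  split_ifs with h1 h2 h2
  · rw [coeff_qInt, if_pos (by omega)]
  · rw [coeff_qInt, if_neg (by omega)]
  · omega
  · rfl

theorem CoeffSU.string (i l : ℕ) : CoeffSU (2 * i + l) (X ^ i * qInt (l + 1)) where
  nonneg j := by rw [coeff_string]; split_ifs <;> simp
  eq_zero j hj := by rw [coeff_string, if_neg (by omega)]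
  symm a b h := by
    simp only [coeff_string]
    congr 1
    apply propext
    omega
  le_succ j h := by
    simp only [coeff_string]
    split_ifs <;> omega

theorem CoeffSU.of_mem_stringCone {d : ℕ} {f : ℤ[X]} (hf : f ∈ stringCone d) : CoeffSU d f := by
  induction hf using AddSubmonoid.closure_induction with
  | mem f hf =>
    obtain ⟨i, l, rfl, rfl⟩ := hf
    exact CoeffSU.string i l
  | zero => exact CoeffSU.zero d
  | add f g _ _ hf hg => exact hf.add hg

theorem CoeffSU.coeff_mono {d : ℕ} {f : ℤ[X]} (hf : CoeffSU d f) {i j : ℕ} (hij : i ≤ j)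
    (hj : i + j ≤ d) : f.coeff i ≤ f.coeff j := by
  have key : ∀ j, i ≤ j → 2 * j ≤ d + 1 → f.coeff i ≤ f.coeff j := by
    intro j hij
    induction j, hij using Nat.le_induction with
    | base => simp
    | succ j hij ih => intro h; exact (ih (by omega)).trans (hf.le_succ j (by omega))
  by_cases h : 2 * j ≤ d + 1
  · exact key j hij h
  -- Past the middle, `j` is reflected to `d - j`, which is still at least `i`.
  · rw [hf.symm j (d - j) (by omega)]
    exact key _ (by omega) (by omega)

/-- The constant coefficient is the least one on `0, …, d`. Subtracting that many full strings
leaves nonnegative coefficients and kills both ends, so the remainder is `X` times a polynomial of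
the same kind for `d - 2`. -/
theorem CoeffSU.mem_stringCone {d : ℕ} {f : ℤ[X]} (hf : CoeffSU d f) : f ∈ stringCone d := by
  induction d using Nat.strong_induction_on generalizing f with
  | _ d ih =>
    have hstr : f.coeff 0 • qInt (d + 1) ∈ stringCone d := by
      obtain ⟨a, ha⟩ := Int.eq_ofNat_of_zero_le (hf.nonneg 0)
      rw [ha, natCast_zsmul]
      exact nsmul_mem (qInt_mem_stringCone d) a
    have hc : ∀ j, (f - f.coeff 0 • qInt (d + 1)).coeff j =
        if j ≤ d then f.coeff j - f.coeff 0 else 0 := by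
      intro j
      rw [coeff_sub, coeff_smul, coeff_qInt]
      by_cases h : j ≤ d
      · simp [h, Nat.lt_succ_of_le h]
      · simp [h, show ¬ j < d + 1 by omega, hf.eq_zero j (by omega)]
    have hd : (f - f.coeff 0 • qInt (d + 1)).coeff d = 0 := by
      rw [hc, if_pos le_rfl, hf.symm d 0 (by omega), sub_self]
    have hX : X * (f - f.coeff 0 • qInt (d + 1)).divX = f - f.coeff 0 • qInt (d + 1) := by
      conv_rhs => rw [← X_mul_divX_add (f - f.coeff 0 • qInt (d + 1))]
      rw [hc]; simp
    rw [← sub_add_cancel f (f.coeff 0 • qInt (d + 1))]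
    refine add_mem ?_ hstr
    -- Here only the exponents `0` and `d` exist, and both have been cancelled.
    by_cases h2 : d < 2
    · convert zero_mem (stringCone d)
      ext j
      rw [coeff_zero]
      rcases Nat.lt_trichotomy j d with h | rfl | h
      · have : j = 0 := by omega
        subst this
        rw [hc]; simp
      · exact hd
      · rw [hc, if_neg (by omega)]
    · obtain ⟨e, rfl⟩ : ∃ e, d = 2 * 1 + e := ⟨d - 2, by omega⟩
      rw [← hX, ← pow_one (X : ℤ[X])]
      refine X_pow_mul_mem_stringCone (ih e (by omega) ?_) 1
      constructor
      · intro j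
        rw [coeff_divX, hc]
        split_ifs with h
        · exact sub_nonneg.2 (hf.coeff_mono (by omega) (by omega))
        · exact le_rfl
      · intro j hj
        rw [coeff_divX]
        rcases Nat.lt_or_ge (2 * 1 + e) (j + 1) with h | h
        · rw [hc, if_neg (by omega)]
        · rw [show j + 1 = 2 * 1 + e by omega, hd]
      · intro i j hij
        rw [coeff_divX, coeff_divX, hc, hc, if_pos (by omega), if_pos (by omega),
          hf.symm (i + 1) (j + 1) (by omega)]
      · intro j hj
        rw [coeff_divX, coeff_divX, hc, hc, if_pos (by omega), if_pos (by omega)]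
        exact sub_le_sub_right (hf.le_succ (j + 1) (by omega)) _

theorem CoeffSU.isZSU {d : ℕ} {f : ℤ[X]} (hf : CoeffSU d f) : IsZSU d f := by
  by_cases h0 : f = 0
  · exact Or.inl h0
  right
  have hN : f.coeff f.natDegree ≠ 0 := by
    rw [coeff_natDegree]; exact leadingCoeff_ne_zero.2 h0
  have hM : f.coeff f.natTrailingDegree ≠ 0 := by
    have := trailingCoeff_nonzero_iff_nonzero.2 h0
    exact this
  have hNd : f.natDegree ≤ d := by
    by_contra h
    exact hN (hf.eq_zero _ (by omega))
  have hMN := natTrailingDegree_le_natDegree f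
  -- Reflecting the lowest exponent bounds the highest one, and conversely; together they give darga
  -- `d`.
  have h1 : d - f.natTrailingDegree ≤ f.natDegree := by
    apply le_natDegree_of_ne_zero
    rwa [← hf.symm f.natTrailingDegree _ (by omega)]
  have h2 : f.natTrailingDegree ≤ d - f.natDegree := by
    apply natTrailingDegree_le_of_ne_zero
    rwa [← hf.symm f.natDegree _ (by omega)]
  refine ⟨hf.nonneg, ?_, ⟨d / 2, by omega, by omega, ?_, ?_⟩, by unfold darga; omega⟩
  · intro k hk
    exact hf.symm _ _ (by omega)
  · intro j _ hj
    exact hf.le_succ j (by omega)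
  · intro j hj hjN
    rw [hf.symm (j + 1) (d - (j + 1)) (by omega), hf.symm j (d - j) (by omega)]
    exact hf.coeff_mono (by omega) (by omega)

/-! ### Gaussian binomials and their summation formulas -/

/-- The Gaussian binomial coefficient, as a polynomial in `q = X`. -/
noncomputable def gauss : ℕ → ℕ → ℤ[X]
  | _, 0 => 1
  | 0, _ + 1 => 0
  | n + 1, k + 1 => gauss n k + X ^ (k + 1) * gauss n (k + 1)

@[simp] theorem gauss_zero_right (n : ℕ) : gauss n 0 = 1 := by cases n <;> rfl

theorem gauss_succ_succ (n k : ℕ) :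
    gauss (n + 1) (k + 1) = gauss n k + X ^ (k + 1) * gauss n (k + 1) := rfl

theorem gauss_eq_zero {n k : ℕ} (h : n < k) : gauss n k = 0 := by
  induction n generalizing k with
  | zero => obtain ⟨k, rfl⟩ : ∃ j, k = j + 1 := ⟨k - 1, by omega⟩; rfl
  | succ n ih =>
    obtain ⟨k, rfl⟩ : ∃ j, k = j + 1 := ⟨k - 1, by omega⟩
    rw [gauss_succ_succ, ih (by omega), ih (by omega)]; simp

@[simp] theorem gauss_self (n : ℕ) : gauss n n = 1 := by
  induction n with
  | zero => rfl
  | succ n ih => rw [gauss_succ_succ, ih, gauss_eq_zero (by omega)]; simp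

/-- The `q`-factorial. -/
noncomputable def qFact (n : ℕ) : ℤ[X] := ∏ i ∈ range n, qInt (i + 1)

theorem qFact_succ (n : ℕ) : qFact (n + 1) = qFact n * qInt (n + 1) := prod_range_succ _ _

theorem qFact_ne_zero (n : ℕ) : qFact n ≠ 0 := prod_ne_zero_iff.2 fun i _ => qInt_ne_zero i

/-- The factorial formula turns the product identities below into cancellations. It follows from the
Pascal recurrence and `qInt_add`. -/
theorem gauss_mul_qFact (a b : ℕ) : gauss (a + b) a * (qFact a * qFact b) = qFact (a + b) := by
  induction a generalizing b with
  | zero => simp [qFact]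
  | succ a iha =>
    induction b with
    | zero => simp [qFact]
    | succ b ihb =>
      have h1 := iha (b + 1)
      rw [show a + 1 + b = a + (b + 1) by ring] at ihb
      rw [show a + 1 + (b + 1) = a + (b + 1) + 1 by ring, gauss_succ_succ, qFact_succ (a + (b + 1)),
        show a + (b + 1) + 1 = a + 1 + (b + 1) by ring, qInt_add (a + 1), qFact_succ a]
      rw [qFact_succ a] at ihb
      rw [qFact_succ b] at h1 ⊢
      linear_combination (qInt (a + 1)) * h1 + (X ^ (a + 1) * qInt (b + 1)) * ihb

theorem gauss_symm (a b : ℕ) : gauss (a + b) a = gauss (a + b) b := by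
  apply mul_right_cancel₀ (mul_ne_zero (qFact_ne_zero a) (qFact_ne_zero b))
  have h := gauss_mul_qFact b a
  rw [add_comm b a, mul_comm (qFact b)] at h
  rw [gauss_mul_qFact, h]

/-- Both sides are the `q`-trinomial coefficient `[a + l + r]! / ([a]! [l]! [r]!)`. -/
theorem gauss_mul_gauss_add (a l r : ℕ) :
    gauss (a + l + r) a * gauss (l + r) l = gauss (a + l + r) (a + l) * gauss (a + l) l := by
  apply mul_right_cancel₀
    (mul_ne_zero (qFact_ne_zero a) (mul_ne_zero (qFact_ne_zero l) (qFact_ne_zero r)))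
  have h1 := gauss_mul_qFact a (l + r)
  have h2 := gauss_mul_qFact l r
  have h3 := gauss_mul_qFact (a + l) r
  have h4 := gauss_mul_qFact a l
  rw [gauss_symm] at h4
  rw [← add_assoc] at h1
  linear_combination (gauss (a + l + r) a * qFact a) * h2 + h1 - h3
    - (gauss (a + l + r) (a + l) * qFact r) * h4

theorem gauss_mul_gauss_sub {N a : ℕ} (l : ℕ) (h : a ≤ N) :
    gauss N a * gauss (N - a) l = gauss N (a + l) * gauss (a + l) l := by
  obtain ⟨c, rfl⟩ := Nat.exists_eq_add_of_le h
  rw [Nat.add_sub_cancel_left]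
  rcases Nat.lt_or_ge c l with hl | hl
  · rw [gauss_eq_zero hl, gauss_eq_zero (show a + c < a + l by omega)]; simp
  · obtain ⟨r, rfl⟩ := Nat.exists_eq_add_of_le hl
    rw [← add_assoc]
    exact gauss_mul_gauss_add a l r

/-- The `q`-Vandermonde convolution. -/
theorem gauss_add (x y r : ℕ) : gauss (x + y) r =
    ∑ p ∈ antidiagonal r, X ^ ((x - p.1) * p.2) * (gauss x p.1 * gauss y p.2) := by
  induction x generalizing r with
  | zero =>
    cases r with
    | zero => simp
    | succ r =>
      rw [Nat.sum_antidiagonal_succ, sum_eq_zero]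
      · simp
      · intro p _
        simp [gauss_eq_zero (show 0 < p.1 + 1 by omega)]
  | succ x ih =>
    cases r with
    | zero => simp
    | succ r =>
      rw [show x + 1 + y = x + y + 1 by ring, gauss_succ_succ, ih r, ih (r + 1),
        Nat.sum_antidiagonal_succ, Nat.sum_antidiagonal_succ, mul_add, mul_sum]
      simp only [gauss_succ_succ]
      -- Pascal's rule splits each summand into one for `r` and one for `r + 1`. Truncation in `x -
      -- (i + 1)` is harmless, since `gauss x (i + 1)` vanishes there.
      have : ∀ p ∈ antidiagonal r,
          X ^ ((x + 1 - (p.1 + 1)) * p.2) * ((gauss x p.1 + X ^ (p.1 + 1) * gauss x (p.1 + 1)) *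
            gauss y p.2) = X ^ ((x - p.1) * p.2) * (gauss x p.1 * gauss y p.2) +
          X ^ (r + 1) * (X ^ ((x - (p.1 + 1)) * p.2) * (gauss x (p.1 + 1) * gauss y p.2)) := by
        rintro ⟨i, j⟩ hp
        rw [HasAntidiagonal.mem_antidiagonal] at hp
        dsimp only at hp ⊢
        subst hp
        rcases Nat.lt_or_ge x (i + 1) with h | h
        · rw [gauss_eq_zero h, Nat.add_sub_add_right]; ring
        · obtain ⟨c, rfl⟩ := Nat.exists_eq_add_of_le h
          rw [show i + 1 + c + 1 - (i + 1) = c + 1 by omega, show i + 1 + c - i = c + 1 by omega,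
            show i + 1 + c - (i + 1) = c by omega]
          ring
      rw [sum_congr rfl this, sum_add_distrib]
      simp only [gauss_zero_right, Nat.sub_zero]
      ring

theorem sum_antidiagonal_assoc {M : Type*} [AddCommMonoid M] (n : ℕ) (f : ℕ → ℕ → ℕ → M) :
    ∑ p ∈ antidiagonal n, ∑ r ∈ antidiagonal p.2, f p.1 r.1 r.2 =
      ∑ p ∈ antidiagonal n, ∑ r ∈ antidiagonal p.1, f r.1 r.2 p.2 := by
  rw [sum_sigma', sum_sigma']
  refine sum_bij' (fun x _ => ⟨(x.1.1 + x.2.1, x.2.2), (x.1.1, x.2.1)⟩)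
    (fun x _ => ⟨(x.2.1, x.2.2 + x.1.2), (x.2.2, x.1.2)⟩) ?_ ?_ ?_ ?_ ?_
  · rintro ⟨⟨a, b⟩, ⟨c, d⟩⟩ h
    simp only [mem_sigma, HasAntidiagonal.mem_antidiagonal] at h ⊢
    obtain ⟨rfl, rfl⟩ := h
    simp [add_assoc]
  · rintro ⟨⟨a, b⟩, ⟨c, d⟩⟩ h
    simp only [mem_sigma, HasAntidiagonal.mem_antidiagonal] at h ⊢
    obtain ⟨rfl, rfl⟩ := h
    simp [add_assoc]
  · rintro ⟨⟨a, b⟩, ⟨c, d⟩⟩ h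
    simp only [mem_sigma, HasAntidiagonal.mem_antidiagonal] at h ⊢
    obtain ⟨-, rfl⟩ := h
    rfl
  · rintro ⟨⟨a, b⟩, ⟨c, d⟩⟩ h
    simp only [mem_sigma, HasAntidiagonal.mem_antidiagonal] at h ⊢
    obtain ⟨-, rfl⟩ := h
    rfl
  · intros; rfl

/-- This is `q`-Vandermonde for `(m + k) + b`, after `gauss (m + k) (m - u) = gauss (m + k) (k +
u)`. The ranges `u ≤ b` and `u ≤ m` differ only by vanishing terms. -/
theorem sum_gauss_mul_gauss (m k b : ℕ) :
    ∑ p ∈ antidiagonal b, X ^ (p.1 * (k + p.1)) * (gauss (m + k) (k + p.1) * gauss b p.1) =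
      gauss (m + k + b) m := by
  rw [gauss_add, ← Nat.sum_antidiagonal_swap (n := m),
    Nat.sum_antidiagonal_eq_sum_range_succ_mk, Nat.sum_antidiagonal_eq_sum_range_succ_mk]
  dsimp only [Prod.swap, Prod.fst, Prod.snd]
  have h1 : ∑ u ∈ range b.succ, X ^ (u * (k + u)) * (gauss (m + k) (k + u) * gauss b u) =
      ∑ u ∈ range (m + b).succ, X ^ (u * (k + u)) * (gauss (m + k) (k + u) * gauss b u) := by
    apply sum_subset
    · intro u; simp only [mem_range]; omega
    · intro u _ h
      simp only [mem_range] at h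
      rw [gauss_eq_zero (show b < u by omega)]; simp
  have h2 : ∑ u ∈ range m.succ, X ^ (u * (k + u)) * (gauss (m + k) (k + u) * gauss b u) =
      ∑ u ∈ range (m + b).succ, X ^ (u * (k + u)) * (gauss (m + k) (k + u) * gauss b u) := by
    apply sum_subset
    · intro u; simp only [mem_range]; omega
    · intro u _ h
      simp only [mem_range] at h
      rw [gauss_eq_zero (show m + k < k + u by omega)]; simp
  rw [h1, ← h2]
  refine sum_congr rfl fun u hu => ?_
  simp only [mem_range] at hu
  obtain ⟨c, rfl⟩ := Nat.exists_eq_add_of_le (show u ≤ m by omega)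
  have h := gauss_symm (k + u) c
  rw [show k + u + c = u + c + k by ring] at h
  rw [show u + c - u = c by omega, show u + c + k - c = k + u by omega, h, mul_comm u]

/-- The `q`-Pfaff–Saalschütz summation in the form of a product formula. -/
theorem gauss_mul_gauss_eq_sum (a k b m : ℕ) :
    gauss (a + k + b) b * gauss (m + k + b) m =
      ∑ p ∈ antidiagonal b, X ^ (p.1 * (k + p.1)) *
        (gauss a p.1 * gauss (m + k) (k + p.1) * gauss (a + k + m + p.2) p.2) := by
  -- Vandermonde for the top `(a + k + b) + (m - i)` expands the last factor; a trinomial identity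
  -- then merges `gauss (m + k) (k + i)` with `gauss (m - i) l`.
  have hR : ∀ p ∈ antidiagonal b, X ^ (p.1 * (k + p.1)) *
      (gauss a p.1 * gauss (m + k) (k + p.1) * gauss (a + k + m + p.2) p.2) =
      ∑ r ∈ antidiagonal p.2, X ^ (p.1 * (k + p.1) + (a + k + p.1 + r.1) * r.1) *
        (gauss a p.1 * gauss (m + k) (k + p.1 + r.1) * gauss (k + p.1 + r.1) r.1 *
          gauss (a + k + b) r.2) := by
    rintro ⟨i, j⟩ hp
    rw [HasAntidiagonal.mem_antidiagonal] at hp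
    dsimp only at hp ⊢
    subst hp
    rcases Nat.lt_or_ge m i with h | h
    · rw [gauss_eq_zero (show m + k < k + i by omega), sum_eq_zero]
      · simp
      · intro r _
        rw [gauss_eq_zero (show m + k < k + i + r.1 by omega)]; simp
    · obtain ⟨c, rfl⟩ := Nat.exists_eq_add_of_le h
      rw [show a + k + (i + c) + j = a + k + (i + j) + c by ring,
        gauss_add (a + k + (i + j)), ← Nat.sum_antidiagonal_swap, mul_sum, mul_sum]
      refine sum_congr rfl fun r hr => ?_
      obtain ⟨l, p⟩ := r
      rw [HasAntidiagonal.mem_antidiagonal] at hr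
      dsimp only [Prod.swap, Prod.fst, Prod.snd] at hr ⊢
      subst hr
      have h3 := gauss_mul_gauss_sub l (show k + i ≤ i + c + k by omega)
      rw [show i + c + k - (k + i) = c by omega] at h3
      rw [show a + k + (i + (l + p)) - p = a + k + i + l by omega, pow_add]
      linear_combination (X ^ (i * (k + i)) * X ^ ((a + k + i + l) * l) * gauss a i *
        gauss (a + k + (i + (l + p))) p) * h3
  rw [sum_congr rfl hR, sum_antidiagonal_assoc b fun i l p =>
    X ^ (i * (k + i) + (a + k + i + l) * l) * (gauss a i * gauss (m + k) (k + i + l) *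
      gauss (k + i + l) l * gauss (a + k + b) p), ← sum_gauss_mul_gauss, mul_sum]
  refine sum_congr rfl fun p hp => ?_
  obtain ⟨u, p⟩ := p
  rw [HasAntidiagonal.mem_antidiagonal] at hp
  dsimp only at hp ⊢
  -- With `u = i + l` the exponent equals `u (k + u) + (a - i) l`, so the sum over `i` is
  -- Vandermonde for `gauss (a + k + u) u`.
  have hS : ∀ r ∈ antidiagonal u, X ^ (r.1 * (k + r.1) + (a + k + r.1 + r.2) * r.2) *
      (gauss a r.1 * gauss (m + k) (k + r.1 + r.2) * gauss (k + r.1 + r.2) r.2 *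
        gauss (a + k + b) p) = X ^ (u * (k + u)) * gauss (m + k) (k + u) * gauss (a + k + b) p *
      (X ^ ((a - r.1) * r.2) * (gauss a r.1 * gauss (k + u) r.2)) := by
    rintro ⟨i, l⟩ hr
    rw [HasAntidiagonal.mem_antidiagonal] at hr
    dsimp only at hr ⊢
    subst hr
    rcases Nat.lt_or_ge a i with h | h
    · rw [gauss_eq_zero h]; simp
    · obtain ⟨c, rfl⟩ := Nat.exists_eq_add_of_le h
      rw [Nat.add_sub_cancel_left, add_assoc k i l]
      ring
  rw [sum_congr rfl hS, ← mul_sum, ← gauss_add]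
  subst hp
  have h4 := gauss_mul_gauss_add (a + k) u p
  have h5 := gauss_symm (a + k) (u + p)
  have h6 := gauss_symm (a + k + u) p
  rw [← add_assoc] at h5
  rw [h5, h6] at h4
  rw [← add_assoc (a + k), ← add_assoc a k u]
  linear_combination (X ^ (u * (k + u)) * gauss (m + k) (k + u)) * h4

/-! ### Gaussian binomials count multisets by their sum -/

/-- The sum of the multiset of numbers in `{0, …, s}` with multiplicities `e`. -/
def boxWeight {s : ℕ} (e : Fin (s + 1) → ℕ) : ℕ :=
  ∑ c : Fin (s + 1), (c : ℕ) * e c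

/-- The generating polynomial of the multisets of size `m` in `{0, …, s}` by their sum. -/
noncomputable def boxPoly (m s : ℕ) : ℤ[X] :=
  ∑ e ∈ piAntidiag (univ : Finset (Fin (s + 1))) m, X ^ boxWeight e

theorem boxWeight_cons_zero {s : ℕ} (e : Fin (s + 1) → ℕ) :
    boxWeight (Fin.cons 0 e : Fin (s + 1 + 1) → ℕ) = boxWeight e + ∑ c, e c := by
  unfold boxWeight
  rw [Fin.sum_univ_succ]
  simp [add_mul, sum_add_distrib]

/-- If `0` occurs, one copy is removed without changing the sum; otherwise each of the `m + 1`
elements is lowered by one. -/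
theorem boxPoly_succ_succ (m s : ℕ) :
    boxPoly (m + 1) (s + 1) = boxPoly m (s + 1) + X ^ (m + 1) * boxPoly (m + 1) s := by
  rw [boxPoly, ← sum_filter_add_sum_filter_not _ (fun e : Fin (s + 1 + 1) → ℕ => e 0 ≠ 0)]
  congr 1
  · unfold boxPoly
    symm
    refine sum_bij' (fun e _ => Fin.cons (e 0 + 1) (Fin.tail e))
      (fun e _ => Fin.cons (e 0 - 1) (Fin.tail e)) ?_ ?_ ?_ ?_ ?_
    · intro e he
      simp only [mem_piAntidiag, mem_filter, Fin.sum_univ_succ, Fin.cons_zero, Fin.cons_succ,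
        Fin.tail, mem_univ, implies_true, and_true] at he ⊢
      omega
    · intro e he
      simp only [mem_piAntidiag, mem_filter, Fin.sum_univ_succ, Fin.cons_zero, Fin.cons_succ,
        Fin.tail, mem_univ, implies_true, and_true] at he ⊢
      omega
    · intro e he
      simp
    · intro e he
      rw [mem_filter] at he
      simp [Nat.sub_add_cancel (Nat.pos_of_ne_zero he.2)]
    · intro e he
      congr 1
      unfold boxWeight
      simp [Fin.sum_univ_succ, Fin.tail]
  · unfold boxPoly
    symm
    rw [mul_sum]
    refine sum_bij' (fun e _ => Fin.cons 0 e) (fun e _ => Fin.tail e) ?_ ?_ ?_ ?_ ?_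
    · intro e he
      simpa [Fin.sum_univ_succ] using he
    · intro e he
      simp only [mem_piAntidiag, mem_filter, Fin.sum_univ_succ, Fin.tail, mem_univ, implies_true,
        and_true, not_not] at he ⊢
      omega
    · intro e he
      simp
    · intro e he
      simp only [mem_filter, not_not] at he
      have := Fin.cons_self_tail e
      rwa [he.2] at this
    · intro e he
      rw [boxWeight_cons_zero, ← pow_add, add_comm]
      simp only [mem_piAntidiag] at he
      rw [he.1]

theorem boxPoly_eq_gauss (m s : ℕ) : boxPoly m s = gauss (m + s) m := by
  induction m generalizing s with
  | zero => simp [boxPoly, boxWeight]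
  | succ m ihm =>
    induction s with
    | zero =>
      have : piAntidiag (univ : Finset (Fin (0 + 1))) (m + 1) = {fun _ => m + 1} := by
        ext e
        simp [funext_iff, Fin.forall_fin_one]
      rw [boxPoly, this]
      simp [boxWeight]
    | succ s ihs =>
      rw [boxPoly_succ_succ, ihm, ihs, ← add_assoc (m + 1), gauss_succ_succ,
        show m + (s + 1) = m + 1 + s by ring]

theorem coeff_boxPoly (m s w : ℕ) : (boxPoly m s).coeff w =
    #{e ∈ piAntidiag (univ : Finset (Fin (s + 1))) m | boxWeight e = w} := by
  simp [boxPoly, finsetSum_coeff, coeff_X_pow, eq_comm]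

theorem boxWeight_add_boxWeight_rev {s : ℕ} (e : Fin (s + 1) → ℕ) :
    boxWeight e + boxWeight (e ∘ Fin.rev) = (∑ c, e c) * s := by
  have : boxWeight (e ∘ Fin.rev) = ∑ c : Fin (s + 1), (c.rev : ℕ) * e c := by
    unfold boxWeight
    exact Fintype.sum_equiv Fin.revPerm _ _ fun c => by simp
  rw [this, boxWeight, ← sum_add_distrib, sum_mul]
  refine sum_congr rfl fun c _ => ?_
  rw [← add_mul, Fin.val_rev, mul_comm]
  congr 1
  omega

theorem card_box_symm (m s : ℕ) {i j : ℕ} (h : i + j = m * s) :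
    #{e ∈ piAntidiag (univ : Finset (Fin (s + 1))) m | boxWeight e = i} =
      #{e ∈ piAntidiag (univ : Finset (Fin (s + 1))) m | boxWeight e = j} := by
  have hs : ∀ e : Fin (s + 1) → ℕ, ∑ c, (e ∘ Fin.rev) c = ∑ c, e c := fun e =>
    Fintype.sum_equiv Fin.revPerm _ _ fun c => by simp
  refine card_bij' (fun e _ => e ∘ Fin.rev) (fun e _ => e ∘ Fin.rev) ?_ ?_ ?_ ?_
  · intro e he
    simp only [mem_filter, mem_piAntidiag, hs, mem_univ, implies_true, and_true] at he ⊢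
    have := boxWeight_add_boxWeight_rev e
    rw [he.1] at this
    exact ⟨he.1, by omega⟩
  · intro e he
    simp only [mem_filter, mem_piAntidiag, hs, mem_univ, implies_true, and_true] at he ⊢
    have := boxWeight_add_boxWeight_rev e
    rw [he.1] at this
    exact ⟨he.1, by omega⟩
  · intro e _; ext; simp
  · intro e _; ext; simp

/-! ### Unimodality of Gaussian binomials by `sl₂` -/

/-- A vector killed by `E` and of negative weight `-c` satisfies `E F^(k+1) x = -(k + 1)(c + k) F^k
x` with nonzero factor, so vanishing of `F^N x` descends to `x`. -/
theorem eq_zero_of_raising_eq_zero {M : Type*} [AddCommGroup M] [Module ℚ M]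
    {E F : Module.End ℚ M} {x : M} {c : ℚ} (hc : 0 < c) (hE : E x = 0)
    (hH : ∀ k : ℕ, E (F ((F ^ k) x)) - F (E ((F ^ k) x)) = -(c + 2 * k) • (F ^ k) x)
    {N : ℕ} (hN : (F ^ N) x = 0) : x = 0 := by
  have hF : ∀ k : ℕ, (F ^ (k + 1)) x = F ((F ^ k) x) := fun k => by
    rw [pow_succ']; rfl
  have key : ∀ k : ℕ, E ((F ^ (k + 1)) x) = -((k + 1) * c + k * (k + 1)) • (F ^ k) x := by
    intro k
    induction k with
    | zero =>
      have := hH 0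
      rw [hF]
      simp only [pow_zero, Module.End.one_apply, hE, map_zero, sub_zero] at this ⊢
      rw [this]
      simp
    | succ k ih =>
      have := hH (k + 1)
      rw [ih, map_smul, ← hF, ← hF, sub_eq_iff_eq_add] at this
      rw [this, ← add_smul]
      congr 1
      push_cast
      ring
  induction N with
  | zero => simpa using hN
  | succ k ih =>
    apply ih
    have h := key k
    rw [hN, map_zero, eq_comm, smul_eq_zero] at h
    refine h.resolve_left (ne_of_lt ?_)
    have : 0 < (k + 1) * c := by positivity
    have : (0 : ℚ) ≤ k * (k + 1) := by positivity
    linarith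

section Sl2

open MvPolynomial

/-- The raising operator `x_i ↦ (i + 1) x_{i + 1}`. -/
noncomputable def raising (s : ℕ) :
    Derivation ℚ (MvPolynomial (Fin (s + 1)) ℚ) (MvPolynomial (Fin (s + 1)) ℚ) :=
  mkDerivation ℚ fun i => if h : (i : ℕ) + 1 < s + 1 then
    ((i : ℚ) + 1) • MvPolynomial.X ⟨i + 1, h⟩ else 0

/-- The lowering operator `x_i ↦ (s - i + 1) x_{i - 1}`. -/
noncomputable def lowering (s : ℕ) :
    Derivation ℚ (MvPolynomial (Fin (s + 1)) ℚ) (MvPolynomial (Fin (s + 1)) ℚ) :=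
  mkDerivation ℚ fun i => if 0 < (i : ℕ) then
    ((s : ℚ) - i + 1) • MvPolynomial.X ⟨i - 1, by omega⟩ else 0

/-- The diagonal operator `x_i ↦ (2 i - s) x_i`. -/
noncomputable def cartan (s : ℕ) :
    Derivation ℚ (MvPolynomial (Fin (s + 1)) ℚ) (MvPolynomial (Fin (s + 1)) ℚ) :=
  mkDerivation ℚ fun i => (2 * (i : ℚ) - s) • MvPolynomial.X i

theorem lie_raising_lowering (s : ℕ) : ⁅raising s, lowering s⁆ = cartan s := by
  apply MvPolynomial.derivation_ext
  intro i
  rw [Derivation.commutator_apply]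
  have h1 : raising s (lowering s (MvPolynomial.X i)) =
      (((s : ℚ) - i + 1) * i) • MvPolynomial.X i := by
    by_cases h : 0 < (i : ℕ)
    · have h' : ((i : ℕ) - 1 + 1) < s + 1 := by omega
      simp only [raising, lowering, MvPolynomial.mkDerivation_X, h, if_true, Derivation.map_smul, h',
        dite_true, smul_smul]
      congr 2
      · rw [Nat.cast_sub (show 1 ≤ (i : ℕ) from h)]; simp
      · ext; simp; omega
    · have h' : (i : ℕ) = 0 := by omega
      rw [lowering, MvPolynomial.mkDerivation_X, if_neg h]
      simp [h']
  have h2 : lowering s (raising s (MvPolynomial.X i)) =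
      (((i : ℚ) + 1) * (s - i)) • MvPolynomial.X i := by
    by_cases h : (i : ℕ) + 1 < s + 1
    · simp only [raising, lowering, MvPolynomial.mkDerivation_X, h, dite_true, Derivation.map_smul,
        Nat.succ_pos, if_true, smul_smul]
      congr 2
      push_cast; ring
    · have h' : (i : ℕ) = s := by omega
      simp [raising, h']
  rw [h1, h2, ← sub_smul, cartan, MvPolynomial.mkDerivation_X]
  congr 1
  ring

/-- The bidegree (degree, weight) of the variables. -/
def bidegree (s : ℕ) (i : Fin (s + 1)) : ℤ × ℤ := (1, i)

theorem weight_bidegree {s : ℕ} (d : Fin (s + 1) →₀ ℕ) :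
    Finsupp.weight (bidegree s) d = (((∑ i, d i : ℕ) : ℤ), ((boxWeight d : ℕ) : ℤ)) := by
  rw [Finsupp.weight_apply, Finsupp.sum_fintype _ _ (by simp)]
  ext
  · simp [Prod.fst_sum, bidegree]
  · simp [Prod.snd_sum, bidegree, boxWeight, mul_comm]

theorem mkDerivation_eq_sum_pderiv {s : ℕ}
    (f : Fin (s + 1) → MvPolynomial (Fin (s + 1)) ℚ) (p : MvPolynomial (Fin (s + 1)) ℚ) :
    mkDerivation ℚ f p = ∑ i, f i * pderiv i p := by
  have hsum : ∀ q : MvPolynomial (Fin (s + 1)) ℚ,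
      (∑ i, f i • pderiv i : Derivation ℚ (MvPolynomial (Fin (s + 1)) ℚ) _) q =
        ∑ i, f i * pderiv i q := fun q => by
    rw [← Derivation.coeFnAddMonoidHom_apply, map_sum, Finset.sum_apply]
    rfl
  have : mkDerivation ℚ f = ∑ i, f i • pderiv i := by
    apply MvPolynomial.derivation_ext
    intro j
    rw [hsum]
    simp [pderiv_X, Pi.single_apply]
  rw [this, hsum]

theorem isWeightedHomogeneous_mkDerivation {s : ℕ} {f : Fin (s + 1) → MvPolynomial (Fin (s + 1)) ℚ}
    {n r : ℤ × ℤ} (hf : ∀ i, (f i).IsWeightedHomogeneous (bidegree s) (bidegree s i + r))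
    {p : MvPolynomial (Fin (s + 1)) ℚ} (hp : p.IsWeightedHomogeneous (bidegree s) n) :
    (mkDerivation ℚ f p).IsWeightedHomogeneous (bidegree s) (n + r) := by
  rw [mkDerivation_eq_sum_pderiv]
  refine IsWeightedHomogeneous.sum _ _ _ fun i _ => ?_
  have h := (hf i).mul (hp.pderiv (i := i) (n' := n - bidegree s i) (by abel))
  convert h using 1
  abel

theorem isWeightedHomogeneous_raising {s : ℕ} {n : ℤ × ℤ} {p : MvPolynomial (Fin (s + 1)) ℚ}
    (hp : p.IsWeightedHomogeneous (bidegree s) n) :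
    (raising s p).IsWeightedHomogeneous (bidegree s) (n + (0, 1)) := by
  refine isWeightedHomogeneous_mkDerivation (fun i => ?_) hp
  split_ifs with h
  · rw [MvPolynomial.smul_eq_C_mul]
    refine IsWeightedHomogeneous.C_mul ?_ _
    convert isWeightedHomogeneous_X ℚ (bidegree s) _ using 1
    simp [bidegree]
  · exact isWeightedHomogeneous_zero _ _ _

theorem isWeightedHomogeneous_lowering {s : ℕ} {n : ℤ × ℤ} {p : MvPolynomial (Fin (s + 1)) ℚ}
    (hp : p.IsWeightedHomogeneous (bidegree s) n) :
    (lowering s p).IsWeightedHomogeneous (bidegree s) (n + (0, -1)) := by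
  refine isWeightedHomogeneous_mkDerivation (fun i => ?_) hp
  split_ifs with h
  · rw [MvPolynomial.smul_eq_C_mul]
    refine IsWeightedHomogeneous.C_mul ?_ _
    convert isWeightedHomogeneous_X ℚ (bidegree s) _ using 1
    simp only [bidegree, Prod.mk_add_mk, add_zero, Prod.mk.injEq, true_and]
    omega
  · exact isWeightedHomogeneous_zero _ _ _

theorem coeff_cartan {s : ℕ} (p : MvPolynomial (Fin (s + 1)) ℚ) (d : Fin (s + 1) →₀ ℕ) :
    (cartan s p).coeff d =
      (2 * (Finsupp.weight (bidegree s) d).2 - s * (Finsupp.weight (bidegree s) d).1 : ℤ) *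
        p.coeff d := by
  classical
  induction p using MvPolynomial.induction_on' with
  | monomial e a =>
    have h : cartan s (monomial e a) =
        ((2 * (Finsupp.weight (bidegree s) e).2 - s * (Finsupp.weight (bidegree s) e).1 : ℤ) : ℚ) •
          monomial e a := by
      rw [cartan, mkDerivation_eq_sum_pderiv]
      have : ∀ i : Fin (s + 1), (2 * (i : ℚ) - s) • MvPolynomial.X i * pderiv i (monomial e a) =
          ((2 * (i : ℚ) - s) * e i) • monomial e a := by
        intro i
        rw [smul_mul_assoc, X_mul_pderiv_monomial, mul_smul, Nat.cast_smul_eq_nsmul]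
      rw [sum_congr rfl fun i _ => this i, ← sum_smul, weight_bidegree]
      congr 1
      simp only [boxWeight]
      push_cast
      rw [mul_sum, mul_sum, ← sum_sub_distrib]
      exact sum_congr rfl fun i _ => by ring
    rw [h, MvPolynomial.coeff_smul, MvPolynomial.coeff_monomial]
    split_ifs with hde
    · rw [hde, smul_eq_mul]
    · simp
  | add p q hp hq => rw [map_add, MvPolynomial.coeff_add, hp, hq, MvPolynomial.coeff_add, mul_add]

theorem cartan_eq_smul {s : ℕ} {n : ℤ × ℤ} {p : MvPolynomial (Fin (s + 1)) ℚ}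
    (hp : p.IsWeightedHomogeneous (bidegree s) n) :
    cartan s p = ((2 * n.2 - s * n.1 : ℤ) : ℚ) • p := by
  ext d
  rw [coeff_cartan, MvPolynomial.coeff_smul, smul_eq_mul]
  by_cases h : p.coeff d = 0
  · simp [h]
  · rw [hp h]

theorem isWeightedHomogeneous_lowering_pow {s : ℕ} {n : ℤ × ℤ}
    {p : MvPolynomial (Fin (s + 1)) ℚ} (hp : p.IsWeightedHomogeneous (bidegree s) n) (k : ℕ) :
    ((((lowering s : _ →ₗ[ℚ] _) : Module.End ℚ (MvPolynomial (Fin (s + 1)) ℚ)) ^ k)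
      p).IsWeightedHomogeneous (bidegree s) (n + (0, -(k : ℤ))) := by
  induction k with
  | zero => simpa [Prod.mk_zero_zero] using hp
  | succ k ih =>
    rw [pow_succ']
    have h : n + (0, -((k + 1 : ℕ) : ℤ)) = n + (0, -(k : ℤ)) + (0, -1) := by
      obtain ⟨a, b⟩ := n
      simp only [Prod.mk_add_mk, Nat.cast_add, Nat.cast_one, add_zero, Prod.mk.injEq, true_and]
      ring
    rw [h]
    exact isWeightedHomogeneous_lowering ih

theorem raising_injective {s : ℕ} {n : ℤ × ℤ} (hn : 2 * n.2 < s * n.1)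
    {p : MvPolynomial (Fin (s + 1)) ℚ} (hp : p.IsWeightedHomogeneous (bidegree s) n)
    (h : raising s p = 0) : p = 0 := by
  refine eq_zero_of_raising_eq_zero (E := (raising s : _ →ₗ[ℚ] _))
    (F := (lowering s : _ →ₗ[ℚ] _)) (c := ((s * n.1 - 2 * n.2 : ℤ) : ℚ)) ?_ h ?_
    -- So many lowerings make the weight negative, where there are no monomials.
    (N := n.2.natAbs + 1) ?_
  · exact_mod_cast sub_pos.2 hn
  · intro k
    have h1 := isWeightedHomogeneous_lowering_pow hp k
    have h2 := cartan_eq_smul h1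
    rw [← lie_raising_lowering, Derivation.commutator_apply] at h2
    refine h2.trans ?_
    congr 1
    push_cast
    simp
    ring
  · refine (isWeightedHomogeneous_lowering_pow hp _).eq_zero_of_no_monomials fun d hd => ?_
    rw [weight_bidegree] at hd
    have := congrArg Prod.snd hd
    simp only [Prod.snd_add] at this
    omega

/-- The multisets of size `m` and sum `w` are the exponents of the monomials of bidegree `(m, w)`, a
basis of that space. Below the middle weight, the raising operator maps it injectively into bidegree
`(m, w + 1)`. -/
theorem card_box_le_succ (m s : ℕ) {w : ℕ} (hw : 2 * w < m * s) :
    #{e ∈ piAntidiag (univ : Finset (Fin (s + 1))) m | boxWeight e = w} ≤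
      #{e ∈ piAntidiag (univ : Finset (Fin (s + 1))) m | boxWeight e = w + 1} := by
  let S : ℕ → Set (Fin (s + 1) →₀ ℕ) := fun w =>
    {d | Finsupp.weight (bidegree s) d = ((m : ℤ), (w : ℤ))}
  let e : ∀ w, S w ≃ {e // e ∈ (piAntidiag (univ : Finset (Fin (s + 1))) m).filter
      fun e => boxWeight e = w} := fun w =>
    Finsupp.equivFunOnFinite.subtypeEquiv fun d => by
      simp only [S, Set.mem_ofPred_eq, weight_bidegree, Prod.mk.injEq, Nat.cast_inj, mem_filter,
        mem_piAntidiag, mem_univ, implies_true, and_true]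
      rfl
  have hS : ∀ w, Module.finrank ℚ (restrictSupport ℚ (S w)) =
      #{e ∈ piAntidiag (univ : Finset (Fin (s + 1))) m | boxWeight e = w} := fun w => by
    rw [Module.finrank_eq_nat_card_basis (basisRestrictSupport ℚ (S w)), Nat.card_congr (e w),
      Nat.card_eq_fintype_card, Fintype.card_coe]
  have hfin : ∀ w, Module.Finite ℚ (restrictSupport ℚ (S w)) := fun w =>
    have : Finite (S w) := Finite.of_equiv _ (e w).symm
    Module.Finite.of_basis (basisRestrictSupport ℚ (S w))
  have hmem : ∀ w p, p ∈ restrictSupport ℚ (S w) ↔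
      p.IsWeightedHomogeneous (bidegree s) ((m : ℤ), (w : ℤ)) := fun w p => by
    rw [mem_restrictSupport_iff]
    constructor
    · intro h d hd
      exact h (MvPolynomial.mem_support_iff.2 hd)
    · intro h d hd
      exact h (MvPolynomial.mem_support_iff.1 hd)
  have hmap : ∀ p ∈ restrictSupport ℚ (S w),
      (raising s : _ →ₗ[ℚ] _) p ∈ restrictSupport ℚ (S (w + 1)) := fun p hp => by
    rw [hmem] at hp ⊢
    simpa using isWeightedHomogeneous_raising hp
  rw [← hS, ← hS]
  refine LinearMap.finrank_le_finrank_of_injective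
    (f := (raising s : _ →ₗ[ℚ] _).restrict hmap) ?_
  rw [← LinearMap.ker_eq_bot, LinearMap.ker_eq_bot']
  rintro ⟨p, hp⟩ h
  rw [Subtype.ext_iff] at h ⊢
  refine raising_injective ?_ ((hmem _ _).1 hp) h
  dsimp only
  rw [mul_comm (s : ℤ)]
  exact_mod_cast hw

end Sl2

theorem coeffSU_boxPoly (m s : ℕ) : CoeffSU (m * s) (boxPoly m s) where
  nonneg j := by rw [coeff_boxPoly]; positivity
  eq_zero j hj := by
    rw [coeff_boxPoly, Nat.cast_eq_zero, card_eq_zero, filter_eq_empty_iff]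
    intro e he
    simp only [mem_piAntidiag, mem_univ, implies_true, and_true] at he
    have := boxWeight_add_boxWeight_rev e
    rw [he] at this
    omega
  symm i j h := by rw [coeff_boxPoly, coeff_boxPoly, card_box_symm m s h]
  le_succ j h := by
    rw [coeff_boxPoly, coeff_boxPoly]
    exact_mod_cast card_box_le_succ m s h

theorem gauss_add_mem_stringCone (m s : ℕ) : gauss (m + s) m ∈ stringCone (m * s) := by
  rw [← boxPoly_eq_gauss]
  exact (coeffSU_boxPoly m s).mem_stringCone

/-! ### Weakly decreasing words and multisets -/

/-- The number of indices at which the value `a` is taken. -/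
def multiplicity {n : ℕ} {α : Type*} [DecidableEq α] (p : Fin n → α) (a : α) : ℕ := #{j | p j = a}

theorem sum_mul_multiplicity {n : ℕ} {α : Type*} [DecidableEq α] [Fintype α] (p : Fin n → α)
    (f : α → ℕ) : ∑ a, f a * multiplicity p a = ∑ j, f (p j) := by
  rw [← sum_fiberwise univ p]
  refine sum_congr rfl fun a _ => ?_
  rw [sum_congr rfl fun j hj => by rw [(mem_filter.1 hj).2], sum_const, smul_eq_mul, mul_comm]
  rfl

theorem multiplicity_comp_perm {n : ℕ} {α : Type*} [DecidableEq α] (p : Fin n → α)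
    (τ : Equiv.Perm (Fin n)) : multiplicity (p ∘ τ) = multiplicity p := by
  ext a
  unfold multiplicity
  refine card_bij' (fun j _ => τ j) (fun j _ => τ.symm j) ?_ ?_ ?_ ?_ <;> simp

theorem antitone_eq_of_multiplicity_eq {n : ℕ} {α : Type*} [LinearOrder α] {p r : Fin n → α}
    (hp : Antitone p) (hr : Antitone r) (h : multiplicity p = multiplicity r) : p = r := by
  have e : ∀ a, Nonempty ({j // p j = a} ≃ {j // r j = a}) := fun a => by
    rw [← Fintype.card_eq, Fintype.card_subtype, Fintype.card_subtype]
    exact congrFun h a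
  let τ : Equiv.Perm (Fin n) := Equiv.ofFiberEquiv fun a => (e a).some
  have hτ : r ∘ τ = p := funext fun j => Equiv.ofFiberEquiv_map _ j
  have := Tuple.unique_antitone (f := r) (σ := τ) (τ := Equiv.refl _) (by rwa [hτ])
    (by simpa using hr)
  rw [← hτ, this]
  rfl

theorem exists_antitone_multiplicity_eq {n : ℕ} {α : Type*} [LinearOrder α] [Fintype α]
    (e : α → ℕ) (he : ∑ a, e a = n) : ∃ p : Fin n → α, Antitone p ∧ multiplicity p = e := by
  have hcard : Fintype.card (Σ a, Fin (e a)) = n := by simp [he]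
  let φ := Fintype.equivFinOfCardEq hcard
  let f : Fin n → α := fun j => (φ.symm j).1
  have hf : multiplicity f = e := by
    ext a
    rw [multiplicity, ← Fintype.card_subtype]
    have h1 : {j // f j = a} ≃ {x : Σ a, Fin (e a) // x.1 = a} :=
      φ.symm.subtypeEquiv fun j => Iff.rfl
    rw [Fintype.card_congr (h1.trans (Equiv.sigmaSubtype a))]
    simp
  let τ := Tuple.sort (fun j => OrderDual.toDual (f j))
  refine ⟨f ∘ τ, ?_, by rw [multiplicity_comp_perm, hf]⟩
  exact Tuple.monotone_sort (fun j => OrderDual.toDual (f j))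

open Classical in
theorem sum_antitone_multiplicity {n : ℕ} {α β : Type*} [LinearOrder α] [Fintype α]
    [AddCommMonoid β] (Φ : (α → ℕ) → β) :
    ∑ p : Fin n → α with Antitone p, Φ (multiplicity p) = ∑ e ∈ piAntidiag univ n, Φ e := by
  refine sum_bij (fun p _ => multiplicity p) ?_ ?_ ?_ ?_
  · intro p _
    have := sum_mul_multiplicity p fun _ => 1
    simpa using this
  · intro p hp r hr h
    exact antitone_eq_of_multiplicity_eq (mem_filter.1 hp).2 (mem_filter.1 hr).2 h
  · intro e he
    obtain ⟨p, hp, rfl⟩ := exists_antitone_multiplicity_eq e (mem_piAntidiag.1 he).1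
    exact ⟨p, by simpa using hp, rfl⟩
  · intros; rfl

open Classical in
theorem sum_antitone_eq_boxPoly (n s : ℕ) :
    ∑ c : Fin n → Fin (s + 1) with Antitone c, (X : ℤ[X]) ^ ∑ j, (c j : ℕ) = boxPoly n s := by
  rw [boxPoly, ← sum_antitone_multiplicity]
  refine sum_congr rfl fun c _ => ?_
  rw [boxWeight, sum_mul_multiplicity c fun a => (a : ℕ)]

/-! ### Descents and compatible sequences -/

theorem antitone_iff_forall_succ_le {n : ℕ} {α : Type*} [Preorder α] {f : Fin n → α} :
    Antitone f ↔ ∀ j (h : j + 1 < n), f ⟨j + 1, h⟩ ≤ f ⟨j, by omega⟩ := by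
  cases n with
  | zero => exact ⟨fun _ j h => by omega, fun _ i => i.elim0⟩
  | succ n =>
    rw [Fin.antitone_iff_succ_le]
    exact ⟨fun h j hj => h ⟨j, by omega⟩, fun h i => h i (by omega)⟩

theorem succ_mem_descents {n t : ℕ} {σ : Fin n → Fin t} {j : ℕ} (h : j + 1 < n) :
    j + 1 ∈ descents σ ↔ σ ⟨j + 1, h⟩ < σ ⟨j, by omega⟩ := by
  simp [descents, h]

theorem one_le_and_lt_of_mem_descents {n t : ℕ} {σ : Fin n → Fin t} {i : ℕ}
    (h : i ∈ descents σ) : 1 ≤ i ∧ i < n := by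
  obtain ⟨h, -⟩ := (mem_filter.1 h).2
  exact h

/-- The number of descents after position `j`, counted from `0`. -/
def tailDes {n t : ℕ} (σ : Fin n → Fin t) (j : ℕ) : ℕ := #{i ∈ descents σ | j < i}

theorem tailDes_eq_succ {n t : ℕ} (σ : Fin n → Fin t) (j : ℕ) :
    tailDes σ j = tailDes σ (j + 1) + if j + 1 ∈ descents σ then 1 else 0 := by
  have h : {i ∈ descents σ | j < i} =
      {i ∈ descents σ | j + 1 < i} ∪ {i ∈ descents σ | i = j + 1} := by
    ext i
    simp only [mem_filter, mem_union, ← and_or_left]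
    refine and_congr_right fun _ => ?_
    omega
  rw [tailDes, h, card_union_of_disjoint, filter_eq']
  · congr 1
    split_ifs <;> simp
  · rw [disjoint_filter]
    intro i _ h1 h2
    omega

theorem tailDes_zero {n t : ℕ} (σ : Fin n → Fin t) : tailDes σ 0 = des σ := by
  rw [tailDes, des, filter_true_of_mem]
  exact fun i hi => (one_le_and_lt_of_mem_descents hi).1

theorem tailDes_eq_zero {n t : ℕ} (σ : Fin n → Fin t) {j : ℕ} (hj : n ≤ j + 1) :
    tailDes σ j = 0 := by
  rw [tailDes, card_eq_zero, filter_eq_empty_iff]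
  intro i hi
  have := one_le_and_lt_of_mem_descents hi
  omega

theorem tailDes_le_des {n t : ℕ} (σ : Fin n → Fin t) (j : ℕ) : tailDes σ j ≤ des σ :=
  card_le_card (filter_subset _ _)

theorem sum_tailDes {n t : ℕ} (σ : Fin n → Fin t) : ∑ j : Fin n, tailDes σ j = maj σ := by
  simp only [tailDes, card_filter]
  rw [sum_comm, maj]
  -- The descent `i` is counted at the `i` positions `0, …, i - 1`.
  refine sum_congr rfl fun i hi => ?_
  have := (one_le_and_lt_of_mem_descents hi).2
  rw [Fin.sum_univ_eq_sum_range (fun j => if j < i then 1 else 0), ← card_filter]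
  rw [show {j ∈ range n | j < i} = range i by ext j; simp; omega, card_range]

/-- With the order of letters reversed, ties in `c` are allowed exactly at non-descents, so `c` must
drop by at least one at each descent, where `tailDes` drops by exactly one. The difference is taken
in `ℤ` because it may be negative for arbitrary `c`. -/
theorem antitone_toLex_iff {n t s : ℕ} (σ : Fin n → Fin t) (c : Fin n → Fin (s + 1)) :
    Antitone (fun j => toLex (c j, OrderDual.toDual (σ j))) ↔
      Antitone (fun j : Fin n => ((c j : ℕ) : ℤ) - tailDes σ j) := by
  rw [antitone_iff_forall_succ_le, antitone_iff_forall_succ_le]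
  refine forall₂_congr fun j h => ?_
  rw [Prod.Lex.toLex_le_toLex, tailDes_eq_succ σ j]
  simp only [succ_mem_descents h, OrderDual.toDual_le_toDual, Fin.lt_def, Fin.ext_iff, Fin.le_def]
  split_ifs with h' <;> push_cast <;> omega

-- Subtracting `tailDes σ` from `c` leaves an arbitrary weakly decreasing word in `{0, …, b}` and
-- lowers the sum by `maj σ`.
open Classical in
theorem sum_compatible_eq {n t : ℕ} (σ : Fin n → Fin t) (s b : ℕ) (hs : des σ + b = s) :
    ∑ c : Fin n → Fin (s + 1) with Antitone (fun j => toLex (c j, OrderDual.toDual (σ j))),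
      (X : ℤ[X]) ^ ∑ j, (c j : ℕ) = X ^ maj σ * boxPoly n b := by
  rw [← sum_antitone_eq_boxPoly, mul_sum]
  -- The difference decreases weakly from at most `s - des σ = b` at the first position to at least
  -- `0` at the last.
  have hc : ∀ c : Fin n → Fin (s + 1), Antitone (fun j => toLex (c j, OrderDual.toDual (σ j))) →
      ∀ j : Fin n, tailDes σ j ≤ c j ∧ (c j : ℕ) - tailDes σ j < b + 1 := by
    intro c hc j
    rw [antitone_toLex_iff] at hc
    have hn := j.pos
    have h0 := hc (show (⟨0, by omega⟩ : Fin n) ≤ j from Nat.zero_le _)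
    have h1 := hc (show j ≤ (⟨n - 1, by omega⟩ : Fin n) from by rw [Fin.le_def]; dsimp; omega)
    dsimp only at h0 h1
    rw [tailDes_zero] at h0
    rw [tailDes_eq_zero σ (show n ≤ n - 1 + 1 by omega)] at h1
    have := (c ⟨0, by omega⟩).2
    constructor <;> omega
  refine sum_bij' (fun c hcm j => ⟨(c j : ℕ) - tailDes σ j, (hc c (mem_filter.1 hcm).2 j).2⟩)
    (fun d _ j => ⟨(d j : ℕ) + tailDes σ j, ?_⟩) ?_ ?_ ?_ ?_ ?_
  · have := tailDes_le_des σ j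
    have := (d j).2
    omega
  · intro c hcm
    have h := (mem_filter.1 hcm).2
    have h' := (antitone_toLex_iff σ c).1 h
    rw [mem_filter]
    refine ⟨mem_univ _, fun i j hij => ?_⟩
    have h1 := h' hij
    have h2 := hc c h i
    have h3 := hc c h j
    rw [Fin.le_def]
    dsimp only at h1 ⊢
    omega
  · intro d hd
    rw [mem_filter] at hd ⊢
    refine ⟨mem_univ _, (antitone_toLex_iff σ _).2 fun i j hij => ?_⟩
    have h1 := hd.2 hij
    rw [Fin.le_def] at h1
    push_cast
    omega
  · intro c hcm
    funext j
    ext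
    have := hc c (mem_filter.1 hcm).2 j
    dsimp only
    omega
  · intro d _
    funext j
    ext
    simp
  · intro c hcm
    rw [← pow_add, ← sum_tailDes, ← sum_add_distrib]
    congr 1
    refine sum_congr rfl fun j _ => ?_
    have := hc c (mem_filter.1 hcm).2 j
    dsimp only
    omega

open Classical in
theorem sum_compatible_eq_zero {n t : ℕ} (σ : Fin n → Fin t) (s : ℕ) (hs : s < des σ) :
    ∑ c : Fin n → Fin (s + 1) with Antitone (fun j => toLex (c j, OrderDual.toDual (σ j))),
      (X : ℤ[X]) ^ ∑ j, (c j : ℕ) = 0 := by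
  rw [sum_eq_zero]
  intro c hcm
  exfalso
  have hc := (antitone_toLex_iff σ c).1 (mem_filter.1 hcm).2
  have hn : 0 < n := by
    obtain ⟨i, hi⟩ := card_pos.1 (show 0 < #(descents σ) from (Nat.zero_le s).trans_lt hs)
    have := one_le_and_lt_of_mem_descents hi
    omega
  have h := hc (show (⟨0, hn⟩ : Fin n) ≤ ⟨n - 1, by omega⟩ from Nat.zero_le _)
  dsimp only at h
  rw [tailDes_zero, tailDes_eq_zero σ (show n ≤ n - 1 + 1 by omega)] at h
  have := (c ⟨0, hn⟩).2
  omega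

/-! ### MacMahon's identity -/

theorem sum_lex_dual {s t : ℕ} {M : Type*} [AddCommMonoid M]
    (F : Lex (Fin (s + 1) × (Fin t)ᵒᵈ) → M) :
    ∑ a, F a = ∑ i : Fin t, ∑ c : Fin (s + 1), F (toLex (c, OrderDual.toDual i)) := by
  rw [← (toLex : Fin (s + 1) × (Fin t)ᵒᵈ ≃ _).sum_comp, Fintype.sum_prod_type_right,
    ← (OrderDual.toDual : Fin t ≃ _).sum_comp]

/-- Choosing a multiset of `v i` values for each letter `i` amounts to choosing one multiset of
pairs (value, letter). -/
theorem prod_boxPoly_eq_sum {t : ℕ} (v : Fin t → ℕ) (s : ℕ) :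
    ∏ i, boxPoly (v i) s =
      ∑ e ∈ piAntidiag (univ : Finset (Lex (Fin (s + 1) × (Fin t)ᵒᵈ))) (∑ i, v i),
        if ∀ i, ∑ c, e (toLex (c, OrderDual.toDual i)) = v i then
          (X : ℤ[X]) ^ ∑ a, ((ofLex a).1 : ℕ) * e a else 0 := by
  simp only [boxPoly]
  rw [prod_univ_sum, ← sum_filter]
  refine sum_bij' (fun g _ a => g (OrderDual.ofDual (ofLex a).2) (ofLex a).1)
    (fun e _ i c => e (toLex (c, OrderDual.toDual i))) ?_ ?_ ?_ ?_ ?_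
  · intro g hg
    simp only [Fintype.mem_piFinset, mem_piAntidiag, mem_univ, implies_true, and_true] at hg
    simp [sum_lex_dual, hg]
  · intro e he
    simp only [mem_filter] at he
    simp [he.2]
  · intro g hg
    rfl
  · intro e he
    rfl
  · intro g hg
    rw [prod_pow_eq_pow_sum, sum_lex_dual]
    rfl

theorem sum_multiplicity_lex {n s t : ℕ} (p : Fin n → Lex (Fin (s + 1) × (Fin t)ᵒᵈ)) (i : Fin t) :
    ∑ c, multiplicity p (toLex (c, OrderDual.toDual i)) =
      #{j | OrderDual.ofDual (ofLex (p j)).2 = i} := by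
  have h := sum_mul_multiplicity p fun a => if OrderDual.ofDual (ofLex a).2 = i then 1 else 0
  rw [sum_lex_dual, ← card_filter] at h
  rw [← h, sum_comm]
  refine sum_congr rfl fun c _ => ?_
  rw [sum_eq_single i]
  · simp
  · intro x _ hx
    simp [hx]
  · simp

-- Listing a multiset of pairs in weakly decreasing lexicographic order gives a word `σ` together
-- with a compatible sequence `c`.
open Classical in
theorem prod_boxPoly_eq_sum_compatible {t : ℕ} (v : Fin t → ℕ) (s : ℕ) :
    ∏ i, boxPoly (v i) s = ∑ σ ∈ multisetPerms v,
      ∑ c : Fin (∑ i, v i) → Fin (s + 1) with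
        Antitone (fun j => toLex (c j, OrderDual.toDual (σ j))), (X : ℤ[X]) ^ ∑ j, (c j : ℕ) := by
  rw [prod_boxPoly_eq_sum, ← sum_antitone_multiplicity, ← sum_filter, filter_filter, sum_sigma']
  refine sum_bij' (fun p _ => ⟨fun j => OrderDual.ofDual (ofLex (p j)).2, fun j => (ofLex (p j)).1⟩)
    (fun x _ j => toLex (x.2 j, OrderDual.toDual (x.1 j))) ?_ ?_ ?_ ?_ ?_
  · intro p hp
    simp only [mem_filter, mem_univ, true_and, sum_multiplicity_lex] at hp
    simp only [mem_sigma, multisetPerms, mem_filter, mem_univ, true_and]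
    exact ⟨hp.2, hp.1⟩
  · rintro ⟨σ, c⟩ hx
    simp only [mem_sigma, multisetPerms, mem_filter, mem_univ, true_and] at hx
    simp only [mem_filter, mem_univ, true_and, sum_multiplicity_lex]
    exact ⟨hx.2, hx.1⟩
  · intro p _
    rfl
  · intro x _
    rfl
  · intro p _
    rw [sum_mul_multiplicity p fun a => ((ofLex a).1 : ℕ)]

/-- MacMahon's generating function identity for descents and major index of multiset
permutations. -/
theorem prod_boxPoly_eq_sum_qEulerian {t : ℕ} (v : Fin t → ℕ) (s : ℕ) :
    ∏ i, boxPoly (v i) s =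
      ∑ p ∈ antidiagonal s, qEulerian v p.1 * boxPoly (∑ i, v i) p.2 := by
  classical
  rw [prod_boxPoly_eq_sum_compatible]
  have hq : ∀ p ∈ antidiagonal s, qEulerian v p.1 * boxPoly (∑ i, v i) p.2 =
      ∑ σ ∈ multisetPerms v,
        if des σ = p.1 then X ^ maj σ * boxPoly (∑ i, v i) p.2 else 0 := fun p _ => by
    rw [qEulerian, sum_mul, sum_filter]
  rw [sum_congr rfl hq, sum_comm]
  refine sum_congr rfl fun σ _ => ?_
  rcases Nat.lt_or_ge s (des σ) with h | h
  · rw [sum_compatible_eq_zero σ s h, sum_eq_zero]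
    rintro ⟨k, b⟩ hp
    rw [HasAntidiagonal.mem_antidiagonal] at hp
    exact if_neg (by dsimp only at hp ⊢; omega)
  · obtain ⟨b, rfl⟩ := Nat.exists_eq_add_of_le h
    rw [sum_compatible_eq σ _ b rfl, sum_eq_single (des σ, b)]
    · simp
    · rintro ⟨k, c⟩ hp hne
      rw [HasAntidiagonal.mem_antidiagonal] at hp
      refine if_neg fun hk => hne ?_
      dsimp only at hp hk
      ext <;> dsimp only <;> omega
    · intro hp
      rw [HasAntidiagonal.mem_antidiagonal] at hp
      exact absurd rfl hp

/-! ### Expansions with coefficients in the string cone -/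

/-- In the equation for `s`, the unknown `f s` has coefficient `gauss n 0 = 1` and all others have
smaller index. -/
theorem eq_of_sum_mul_gauss_eq {n : ℕ} {f g : ℕ → ℤ[X]}
    (h : ∀ s, ∑ p ∈ antidiagonal s, f p.1 * gauss (n + p.2) p.2 =
      ∑ p ∈ antidiagonal s, g p.1 * gauss (n + p.2) p.2) (k : ℕ) : f k = g k := by
  induction k using Nat.strong_induction_on with
  | _ k ih =>
    have hk := h k
    rw [Nat.sum_antidiagonal_eq_sum_range_succ_mk, Nat.sum_antidiagonal_eq_sum_range_succ_mk,
      sum_range_succ, sum_range_succ] at hk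
    dsimp only at hk
    rw [sum_congr rfl fun j hj => by rw [ih j (mem_range.1 hj)]] at hk
    simpa using hk

/-- The dargas add up: `2i(k+i) + i(n-k-i) + (k+i)(m-i) + nk = (n+m)(k+i)`. Where a subtraction
would truncate, the product is zero. -/
theorem summand_mem_stringCone {n m k i : ℕ} {f : ℤ[X]} (hf : f ∈ stringCone (n * k))
    (h0 : n < k → f = 0) :
    X ^ (i * (k + i)) * (gauss (n - k) i * gauss (m + k) (k + i)) * f ∈
      stringCone ((n + m) * (k + i)) := by
  rcases Nat.lt_or_ge n k with h | h
  · simp [h0 h]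
  rcases Nat.lt_or_ge (n - k) i with h1 | h1
  · simp [gauss_eq_zero h1]
  rcases Nat.lt_or_ge m i with h2 | h2
  · simp [gauss_eq_zero (show m + k < k + i by omega)]
  obtain ⟨a, rfl⟩ := Nat.exists_eq_add_of_le h
  rw [Nat.add_sub_cancel_left] at h1 ⊢
  obtain ⟨c, rfl⟩ := Nat.exists_eq_add_of_le h1
  obtain ⟨d, rfl⟩ := Nat.exists_eq_add_of_le h2
  have h3 := gauss_add_mem_stringCone i c
  have h4 := gauss_add_mem_stringCone (k + i) d
  rw [show k + i + d = i + d + k by ring] at h4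
  have h5 := mul_mem_stringCone
    (X_pow_mul_mem_stringCone (mul_mem_stringCone h3 h4) (i * (k + i))) hf
  convert h5 using 2
  ring

theorem exists_stringCone_expansion {ι : Type*} (S : Finset ι) (v : ι → ℕ) :
    ∃ g : ℕ → ℤ[X], (∀ k, g k ∈ stringCone ((∑ i ∈ S, v i) * k)) ∧
      (∀ k, ∑ i ∈ S, v i < k → g k = 0) ∧
      ∀ s, ∏ i ∈ S, gauss (v i + s) (v i) =
        ∑ p ∈ antidiagonal s, g p.1 * gauss (∑ i ∈ S, v i + p.2) p.2 := by
  classical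
  induction S using Finset.induction_on with
  | empty =>
    refine ⟨fun k => if k = 0 then 1 else 0, fun k => ?_, fun k hk => ?_, fun s => ?_⟩
    · rw [sum_empty, zero_mul]
      dsimp only
      split_ifs
      · exact one_mem_stringCone
      · exact zero_mem _
    · rw [sum_empty] at hk
      exact if_neg (by omega)
    · rw [sum_eq_single (0, s)]
      · simp
      · rintro ⟨k, b⟩ hp hne
        rw [HasAntidiagonal.mem_antidiagonal] at hp
        dsimp only at hp ⊢
        rw [if_neg, zero_mul]
        rintro rfl
        exact hne (by simpa using hp)
      · intro hp
        exact absurd (HasAntidiagonal.mem_antidiagonal.2 (zero_add s)) hp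
  | insert x S hx ih =>
    obtain ⟨g, hg, hg0, hgs⟩ := ih
    set n := ∑ i ∈ S, v i
    rw [sum_insert hx]
    -- The pair `p = (k, i)` records the old index and the Pfaff–Saalschütz summation index; the new
    -- index is `J = k + i`.
    refine ⟨fun J => ∑ p ∈ antidiagonal J, X ^ (p.2 * (p.1 + p.2)) *
      (gauss (n - p.1) p.2 * gauss (v x + p.1) (p.1 + p.2)) * g p.1,
      fun J => ?_, fun J hJ => ?_, fun s => ?_⟩
    · refine sum_mem fun p hp => ?_
      rw [HasAntidiagonal.mem_antidiagonal] at hp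
      rw [← hp, add_comm (v x)]
      exact summand_mem_stringCone (hg p.1) (hg0 p.1)
    · refine sum_eq_zero fun p hp => ?_
      rw [HasAntidiagonal.mem_antidiagonal] at hp
      rcases Nat.lt_or_ge n p.1 with h | h
      · rw [hg0 _ h, mul_zero]
      · rw [gauss_eq_zero (show v x + p.1 < p.1 + p.2 by omega)]
        simp
    · rw [prod_insert hx, hgs]
      simp only [sum_mul]
      rw [← sum_antidiagonal_assoc s fun k i j => X ^ (i * (k + i)) *
        (gauss (n - k) i * gauss (v x + k) (k + i)) * g k * gauss (v x + n + j) j, mul_sum]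
      refine sum_congr rfl fun p hp => ?_
      obtain ⟨k, b⟩ := p
      rw [HasAntidiagonal.mem_antidiagonal] at hp
      dsimp only at hp ⊢
      rcases Nat.lt_or_ge n k with h | h
      · rw [hg0 k h]; simp
      -- Pfaff–Saalschütz is applied with `n = a + k` and `s = k + b`; terms with `k > n` were
      -- discarded because `g k = 0`.
      · obtain ⟨a, ha⟩ := Nat.exists_eq_add_of_le' h
        have key := gauss_mul_gauss_eq_sum a k b (v x)
        rw [← ha, add_assoc (v x), hp] at key
        rw [mul_left_comm, mul_comm (gauss _ (v x)), key, mul_sum, ha, Nat.add_sub_cancel]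
        refine sum_congr rfl fun r _ => ?_
        rw [add_comm (v x) (a + k)]
        ring

theorem qEulerian_mem_stringCone {t : ℕ} (v : Fin t → ℕ) (k : ℕ) :
    qEulerian v k ∈ stringCone ((∑ i, v i) * k) := by
  obtain ⟨g, hg, -, hgs⟩ := exists_stringCone_expansion univ v
  rw [eq_of_sum_mul_gauss_eq (n := ∑ i, v i) (f := qEulerian v) (g := g) (fun s => ?_) k]
  · exact hg k
  · rw [← hgs, ← prod_congr rfl fun i _ => boxPoly_eq_gauss (v i) s,
      prod_boxPoly_eq_sum_qEulerian]
    simp only [boxPoly_eq_gauss, gauss_symm]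

end QEulerian

theorem corollary3 {t : ℕ} (v : Fin t → ℕ) (k : ℕ) :
    QEulerian.IsZSU ((∑ i, v i) * k) (QEulerian.qEulerian v k) :=
  (QEulerian.CoeffSU.of_mem_stringCone (QEulerian.qEulerian_mem_stringCone v k)).isZSU
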